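/- Let $\{0,1\}^{\mathbb N}$ be the Cantor space, for a finite binary string $x$ let $[x]$ be the set of all sequences with prefix $x$, and let $T(\omega_0\omega_1\omega_2\dots)=\omega_1\omega_2\dots$ be the shift. Let $P$ be a probability measure on the Cantor space that is stationary (i.e. $T$-invariant) and computable: some algorithm computes $P([x])$, given $x$ and $n$, with error at most $2^{-n}$. Let $f\colon\{0,1\}^{\mathbb N}\to\mathbb R$ be computable: some algorithm with oracle access to the terms of $\omega$ computes, for every $\omega$ and $n$, the value $f(\omega)$ with error at most $2^{-n}$. A set $A\subset\{0,1\}^{\mathbb N}$ is called effectively null (with respect to $P$) if there is an algorithm that, given $k\in\mathbb N$, enumerates strings $x$ whose intervals $[x]$ cover $A$ and have total $P$-measure at most $2^{-k}$. A sequence is called Martin-Löf random (with respect to $P$) if it belongs to no effectively null set. Then $f$ is bounded; for every Martin-Löf random sequence $\omega$ the limit $$\lim_{n\to\infty}\frac{f(\omega)+f(T\omega)+\dots+f(T^{n-1}\omega)}{n}$$ exists (as a real number); and the set of all sequences $\omega$ for which this limit does not exist is effectively null with respect to $P$. -/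

import Mathlib

open MeasureTheory Filter Topology

namespace EffectiveErgodic

/-- The Cantor space of infinite binary sequences. -/
abbrev Cantor : Type := ℕ → Bool

/-- The shift: discard the first term of a sequence. -/
def shift (ω : Cantor) : Cantor := fun i => ω (i + 1)

/-- The interval `[x]`: all sequences that have the finite string `x` as a prefix. -/
def cyl (x : List Bool) : Set Cantor :=
  {ω | ∀ (i : ℕ) (h : i < x.length), ω i = x[i]}

/-- A measure `P` is computable if some algorithm, given a string `x` and a precision `n`, outputs
an integer `m` with `|P([x]) - m / 2 ^ n| ≤ 1 / 2 ^ n`. -/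
def ComputableMeasure (P : Measure Cantor) : Prop :=
  ∃ g : List Bool × ℕ → ℤ, Computable g ∧
    ∀ (x : List Bool) (n : ℕ), |P.real (cyl x) - (g (x, n) : ℝ) / 2 ^ n| ≤ 1 / 2 ^ n

/-- One stage of an oracle algorithm `M` with oracle `ω`. A state `(n, h)` consists of the input `n`
and the list `h` of the oracle's answers received so far, in order. In this state `M` performs an
ordinary (possibly non-terminating) computation, after which it either outputs an integer
(`Sum.inl m`) and halts, or asks for the term of `ω` with some index (`Sum.inr i`); in the latter
case the answer `ω i` is appended to the list of answers. -/
def oracleStep (M : ℕ × List Bool →. ℤ ⊕ ℕ) (ω : Cantor) :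
    ℕ × List Bool →. ℤ ⊕ (ℕ × List Bool) :=
  fun s => (M s).map (Sum.map id fun i => (s.1, s.2 ++ [ω i]))

/-- The output of the oracle algorithm `M` with oracle `ω`, started in a given state: stages are
repeated until one of them halts. It is undefined if this never happens. -/
def oracleRun (M : ℕ × List Bool →. ℤ ⊕ ℕ) (ω : Cantor) : ℕ × List Bool →. ℤ :=
  PFun.fix (oracleStep M ω)

/-- A real function `f` on the Cantor space is computable if there is one oracle algorithm that,
for every `ω`, given a precision `n` and `ω` as an oracle, halts with an integer `m` such that
`|f ω - m / 2 ^ n| ≤ 1 / 2 ^ n`. -/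
def ComputableFunction (f : Cantor → ℝ) : Prop :=
  ∃ M : ℕ × List Bool →. ℤ ⊕ ℕ, Partrec M ∧
    ∀ (ω : Cantor) (n : ℕ), ∃ m ∈ oracleRun M ω (n, []), |f ω - (m : ℝ) / 2 ^ n| ≤ 1 / 2 ^ n

/-- A set `A` is effectively null with respect to `P` if, uniformly in `k`, one can effectively
enumerate intervals that cover `A` and have total measure at most `2 ^ (-k)`. -/
def EffectivelyNull (P : Measure Cantor) (A : Set Cantor) : Prop :=
  ∃ U : ℕ → Set (List Bool),
    REPred (fun q : ℕ × List Bool => q.2 ∈ U q.1) ∧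
    ∀ k : ℕ, A ⊆ (⋃ x ∈ U k, cyl x) ∧ ∑' x : U k, P (cyl (x : List Bool)) ≤ (2 ^ k)⁻¹

/-- A sequence is Martin-Löf random with respect to `P` if it belongs to no effectively null set. -/
def MartinLofRandom (P : Measure Cantor) (ω : Cantor) : Prop :=
  ∀ A : Set Cantor, EffectivelyNull P A → ω ∉ A

/-- The averages `(f ω + f (T ω) + ⋯ + f (T ^ (n - 1) ω)) / n` along the orbit of `ω` under the
shift `T` converge to some real number. -/
def HasOrbitAverage (f : Cantor → ℝ) (ω : Cantor) : Prop :=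
  ∃ L : ℝ, Tendsto (fun n : ℕ => birkhoffAverage ℝ shift f n ω) atTop (𝓝 L)

end EffectiveErgodic

namespace EffectiveErgodic

/-! Divergent averages cross some gap infinitely often, and stationarity bounds the probability of
many crossings by an explicit constant.

For a natural-valued sequence `z` and levels `c`, `c + 1`, let an index set `e` earn `z i - c` at
each member `i` and pay `i + 1` where a run ends at `i`. Shifting `z` by one place makes every run
cheaper by 1, so the optimal gain grows by at least the number of runs of an optimal set, up to the
lost term `z 0` (`gain_add_runs_le`). An optimal set meets every interval from a low to a high
average and contains no interval from a high to a low one, since altering it there would increase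
the gain. So `2 * K` crossings force `K` runs (`upcrossing_le`). Under an invariant measure the
change of the optimal gain integrates to 0, and `2 * K` crossings have probability at most `B / K`
if the values are bounded by `B` (`measureReal_crossings_le`).

By compactness, a computable function has a computable modulus (`exists_modulus`); translated and
scaled, it is approximated by natural-valued functions of a prefix. If the averages diverge, some
approximation `p` and level `c` have unboundedly many crossings (`exists_crossings_unbounded`).
Crossings are computed from prefixes, so excessive counts form enumerable open sets; minimal
witnessing prefixes give disjoint intervals (`effectivelyNull_of_prefix_tests`). Giving the pair
coded by `j` measure at most `2 ^ (-(k + j + 1))` makes the total at most `2 ^ (-k)`. -/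

/-! ### Prefixes and intervals. -/

/-- The prefix of length `n` of a sequence. -/
def pre (ω : Cantor) (n : ℕ) : List Bool := (List.range n).map ω

@[simp] theorem length_pre (ω : Cantor) (n : ℕ) : (pre ω n).length = n := by simp [pre]

theorem mem_cyl_pre (ω : Cantor) (n : ℕ) : ω ∈ cyl (pre ω n) := by
  intro i h
  simp [pre]

theorem mem_cyl_iff {ω : Cantor} {x : List Bool} : ω ∈ cyl x ↔ pre ω x.length = x := by
  constructor
  · intro h
    refine List.ext_getElem (by simp) fun i h₁ h₂ => ?_
    simpa [pre] using h i h₂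
  · intro h
    rw [← h]
    exact mem_cyl_pre _ _

theorem pre_congr {ω ω' : Cantor} {n : ℕ} (h : ∀ i < n, ω i = ω' i) : pre ω n = pre ω' n := by
  refine List.map_congr_left fun i hi => h i (List.mem_range.1 hi)

theorem pre_prefix_pre (ω : Cantor) {m n : ℕ} (h : m ≤ n) : pre ω m <+: pre ω n := by
  refine List.IsPrefix.map ω ?_
  obtain ⟨k, rfl⟩ := Nat.exists_eq_add_of_le h
  exact ⟨_, (List.range_add ..).symm⟩

/-- The sequence obtained from a string by appending zeros. -/
def ext (x : List Bool) : Cantor := fun i => x.getD i false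

theorem mem_cyl_ext (x : List Bool) : ext x ∈ cyl x := by
  intro i h
  simp [ext, h]

/-! ### Oracle computations with a finite part of the oracle. -/

/-- One stage of the oracle algorithm `M` that has access to a finite string only and diverges when
it asks for a term beyond the end of this string. -/
def partialStep (M : ℕ × List Bool →. ℤ ⊕ ℕ) :
    List Bool × (ℕ × List Bool) →. ℤ ⊕ (List Bool × (ℕ × List Bool)) :=
  fun s => (M s.2).bind fun r => Sum.casesOn r (fun m => Part.some (Sum.inl m))
    (fun i => (s.1[i]? : Part Bool).map fun b => Sum.inr (s.1, (s.2.1, s.2.2 ++ [b])))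

theorem partrec_partialStep {M : ℕ × List Bool →. ℤ ⊕ ℕ} (hM : Partrec M) :
    Partrec (partialStep M) := by
  have h₁ : Computable fun q : ((List Bool × (ℕ × List Bool)) × (ℤ ⊕ ℕ)) × ℕ =>
      q.1.1.1[q.2]? :=
    Computable.list_getElem?.comp
      (Computable.fst.comp (Computable.fst.comp Computable.fst)) Computable.snd
  have h₀ : Computable fun q : (((List Bool × (ℕ × List Bool)) × (ℤ ⊕ ℕ)) × ℕ) × Bool =>
      q.1.1.1 := Computable.fst.comp (Computable.fst.comp Computable.fst)
  have h₂ : Computable₂ fun (q : ((List Bool × (ℕ × List Bool)) × (ℤ ⊕ ℕ)) × ℕ) (b : Bool) =>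
      (Sum.inr (q.1.1.1, (q.1.1.2.1, q.1.1.2.2 ++ [b])) : ℤ ⊕ (List Bool × (ℕ × List Bool))) :=
    (Computable.sumInr.comp ((Computable.fst.comp h₀).pair
      ((Computable.fst.comp (Computable.snd.comp h₀)).pair
        (Computable.list_concat.comp (Computable.snd.comp (Computable.snd.comp h₀))
          Computable.snd)))).to₂
  have h₃ : Partrec₂ fun (q : (List Bool × (ℕ × List Bool)) × (ℤ ⊕ ℕ)) (i : ℕ) =>
      (q.1.1[i]? : Part Bool).map fun b =>
        (Sum.inr (q.1.1, (q.1.2.1, q.1.2.2 ++ [b])) : ℤ ⊕ (List Bool × (ℕ × List Bool))) :=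
    (Partrec.map h₁.ofOption h₂).to₂
  have h₄ : Computable₂ fun (_ : (List Bool × (ℕ × List Bool)) × (ℤ ⊕ ℕ)) (m : ℤ) =>
      (Sum.inl m : ℤ ⊕ (List Bool × (ℕ × List Bool))) :=
    (Computable.sumInl.comp Computable.snd).to₂
  exact Partrec.bind (hM.comp Computable.snd)
    (Partrec.sumCasesOn_right Computable.snd h₄ h₃).to₂

theorem inl_mem_partialStep {M : ℕ × List Bool →. ℤ ⊕ ℕ} {s : List Bool × (ℕ × List Bool)} {m : ℤ} :
    Sum.inl m ∈ partialStep M s ↔ Sum.inl m ∈ M s.2 := by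
  simp only [partialStep, Part.mem_bind_iff]
  constructor
  · rintro ⟨r | r, h, h'⟩ <;> simp_all
  · exact fun h => ⟨_, h, by simp⟩

theorem inr_mem_partialStep {M : ℕ × List Bool →. ℤ ⊕ ℕ} {s t : List Bool × (ℕ × List Bool)} :
    Sum.inr t ∈ partialStep M s ↔
      ∃ i b, Sum.inr i ∈ M s.2 ∧ s.1[i]? = some b ∧ t = (s.1, (s.2.1, s.2.2 ++ [b])) := by
  simp only [partialStep, Part.mem_bind_iff]
  constructor
  · rintro ⟨r | r, h, h'⟩
    · simp_all
    · obtain ⟨b, hb, h'⟩ := (Part.mem_map_iff _).1 h'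
      exact ⟨r, b, h, by simpa using hb, by simpa using h'.symm⟩
  · rintro ⟨i, b, h, hb, rfl⟩
    exact ⟨_, h, (Part.mem_map_iff _).2 ⟨b, by simp [hb], rfl⟩⟩

theorem inl_mem_oracleStep {M : ℕ × List Bool →. ℤ ⊕ ℕ} {ω : Cantor} {s : ℕ × List Bool} {m : ℤ} :
    Sum.inl m ∈ oracleStep M ω s ↔ Sum.inl m ∈ M s := by
  simp only [oracleStep, Part.mem_map_iff]
  constructor
  · rintro ⟨r | r, h, h'⟩ <;> simp_all
  · exact fun h => ⟨_, h, by simp⟩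

theorem inr_mem_oracleStep {M : ℕ × List Bool →. ℤ ⊕ ℕ} {ω : Cantor} {s t : ℕ × List Bool} :
    Sum.inr t ∈ oracleStep M ω s ↔ ∃ i, Sum.inr i ∈ M s ∧ t = (s.1, s.2 ++ [ω i]) := by
  simp only [oracleStep, Part.mem_map_iff]
  constructor
  · rintro ⟨r | r, h, h'⟩
    · simp_all
    · exact ⟨r, h, by simpa using h'.symm⟩
  · rintro ⟨i, h, rfl⟩
    exact ⟨_, h, rfl⟩

/-- A halting run on a string has queried only positions inside it, where every sequence of the
interval gives the same answers. -/
theorem oracleRun_of_partialStep {M : ℕ × List Bool →. ℤ ⊕ ℕ} {ω : Cantor} {m : ℤ}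
    {q : List Bool × (ℕ × List Bool)} (h : m ∈ (partialStep M).fix q) (hω : ω ∈ cyl q.1) :
    m ∈ oracleRun M ω q.2 := by
  revert hω
  refine PFun.fixInduction' (C := fun q => ω ∈ cyl q.1 → m ∈ oracleRun M ω q.2) h ?_ ?_
  · exact fun q hq _ => PFun.fix_stop (inl_mem_oracleStep.2 (inl_mem_partialStep.1 hq))
  · intro q r _ hqr ih hω
    obtain ⟨i, b, hi, hb, rfl⟩ := inr_mem_partialStep.1 hqr
    obtain ⟨hl, hb⟩ := List.getElem?_eq_some_iff.1 hb
    exact PFun.mem_fix_iff.2 (Or.inr ⟨_, inr_mem_oracleStep.2 ⟨i, hi, rfl⟩,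
      by rw [hω i hl, hb]; exact ih hω⟩)

theorem fix_partialStep_mono {M : ℕ × List Bool →. ℤ ⊕ ℕ} {m : ℤ} {y : List Bool}
    {q : List Bool × (ℕ × List Bool)} (h : m ∈ (partialStep M).fix q) (hy : q.1 <+: y) :
    m ∈ (partialStep M).fix (y, q.2) := by
  revert hy
  refine PFun.fixInduction' (C := fun q => q.1 <+: y → m ∈ (partialStep M).fix (y, q.2)) h ?_ ?_
  · exact fun q hq _ => PFun.fix_stop (inl_mem_partialStep.2
      (inl_mem_partialStep.1 hq : Sum.inl m ∈ M q.2))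
  · intro q r _ hqr ih hy
    obtain ⟨i, b, hi, hb, rfl⟩ := inr_mem_partialStep.1 hqr
    refine PFun.mem_fix_iff.2 (Or.inr ⟨_, inr_mem_partialStep.2 ⟨i, b, hi, ?_, rfl⟩, ih hy⟩)
    obtain ⟨z, rfl⟩ := hy
    obtain ⟨hl, hb'⟩ := List.getElem?_eq_some_iff.1 hb
    simpa [List.getElem?_append_left hl] using hb

/-- A halting run makes finitely many queries, so a prefix reaching beyond all of them suffices. -/
theorem exists_fix_partialStep {M : ℕ × List Bool →. ℤ ⊕ ℕ} {ω : Cantor} {m : ℤ}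
    {s : ℕ × List Bool} (h : m ∈ oracleRun M ω s) :
    ∃ l, m ∈ (partialStep M).fix (pre ω l, s) := by
  refine PFun.fixInduction' (C := fun s => ∃ l, m ∈ (partialStep M).fix (pre ω l, s)) h ?_ ?_
  · exact fun q hq => ⟨0, PFun.fix_stop (inl_mem_partialStep.2
      (inl_mem_oracleStep.1 hq : Sum.inl m ∈ M q))⟩
  · intro q r _ hqr ih
    obtain ⟨i, hi, rfl⟩ := inr_mem_oracleStep.1 hqr
    obtain ⟨l, hl⟩ := ih
    refine ⟨max l (i + 1), PFun.mem_fix_iff.2 (Or.inr ⟨_, inr_mem_partialStep.2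
      ⟨i, ω i, hi, ?_, rfl⟩, fix_partialStep_mono hl (pre_prefix_pre ω (le_max_left ..))⟩)⟩
    simp [pre]

/-! ### Compactness and the computable modulus. -/

/-- A partial computable function is the limit of its computations with bounded time. -/
theorem exists_stages {α β : Type*} [Primcodable α] [Primcodable β] {A : α →. β} (hA : Partrec A) :
    ∃ φ : ℕ × α → Option β, Primrec φ ∧ (∀ t a b, φ (t, a) = some b → b ∈ A a) ∧
      ∀ a, (A a).Dom → ∃ t, ∀ t' ≥ t, (φ (t', a)).isSome := by
  obtain ⟨c, hc⟩ := Nat.Partrec.Code.exists_code.1 hA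
  have key : ∀ a, c.eval (Encodable.encode a) = (A a).map Encodable.encode := by
    intro a
    rw [hc]
    simp [Encodable.encodek]
  refine ⟨fun q => (c.evaln q.1 (Encodable.encode q.2)).bind Encodable.decode, ?_, ?_, ?_⟩
  · exact Primrec.option_bind (Nat.Partrec.Code.primrec_evaln.comp
      ((Primrec.fst.pair (Primrec.const c)).pair (Primrec.encode.comp Primrec.snd)))
      (Primrec.decode.comp Primrec.snd).to₂
  · intro t a b h
    obtain ⟨v, hv, hb⟩ := Option.bind_eq_some_iff.1 h
    have := Nat.Partrec.Code.evaln_sound hv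
    rw [key] at this
    obtain ⟨b', hb', rfl⟩ := (Part.mem_map_iff _).1 this
    rw [Encodable.encodek] at hb
    exact Option.some.inj hb ▸ hb'
  · intro a ha
    have : Encodable.encode ((A a).get ha) ∈ c.eval (Encodable.encode a) := by
      rw [key]
      exact Part.mem_map _ (Part.get_mem ha)
    obtain ⟨t, ht⟩ := Nat.Partrec.Code.evaln_complete.1 this
    refine ⟨t, fun t' htt => ?_⟩
    have h := Nat.Partrec.Code.evaln_mono htt ht
    rw [Option.mem_def] at h
    simp [h, Encodable.encodek]

/-- All strings of a given length. -/
def strings : ℕ → List (List Bool)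
  | 0 => [[]]
  | n + 1 => (strings n).flatMap fun x => [x ++ [false], x ++ [true]]

theorem mem_strings {n : ℕ} {x : List Bool} : x ∈ strings n ↔ x.length = n := by
  induction n generalizing x with
  | zero => simp [strings]
  | succ n ih =>
    rcases List.eq_nil_or_concat x with rfl | ⟨y, b, rfl⟩
    · simp [strings]
    · simp only [strings, List.mem_flatMap, ih, List.concat_eq_append, List.mem_cons, List.not_mem_nil, or_false,
        List.length_append, List.length_singleton, Nat.add_right_cancel_iff]
      constructor
      · rintro ⟨y', h, h' | h'⟩ <;> rw [(List.append_inj' h' rfl).1, h]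
      · rintro h
        refine ⟨y, h, ?_⟩
        cases b <;> simp

theorem primrec_strings : Primrec strings := by
  refine (Primrec.nat_rec₁ [[]] (f := fun _ (l : List (List Bool)) => l.flatMap fun x => [x ++ [false], x ++ [true]])
    ?_).of_eq fun n => ?_
  · refine (Primrec.list_flatMap (f := fun q : ℕ × List (List Bool) => q.2)
      (g := fun _ x => [x ++ [false], x ++ [true]]) Primrec.snd ?_).to₂
    refine (Primrec.list_cons.comp (Primrec.list_concat.comp Primrec.snd (Primrec.const false))
      (Primrec.list_cons.comp (Primrec.list_concat.comp Primrec.snd (Primrec.const true))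
        (Primrec.const [])) ).to₂
  · induction n with
    | zero => rfl
    | succ n ih => simp only [strings, ← ih]

theorem isOpen_of_pre {U : Set Cantor} (l : ℕ) (h : ∀ ω ω' : Cantor, pre ω l = pre ω' l → ω ∈ U → ω' ∈ U) :
    IsOpen U := by
  rw [isOpen_iff_mem_nhds]
  intro ω hω
  have : {ω' : Cantor | ∀ i ∈ Finset.range l, ω' i = ω i} ∈ 𝓝 ω := by
    have : ∀ i ∈ Finset.range l, ∀ᶠ ω' : Cantor in 𝓝 ω, ω' i = ω i := fun i _ =>
      by
      have h : IsOpen {ω' : Cantor | ω' i = ω i} :=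
        (isOpen_discrete {ω i}).preimage (continuous_apply (A := fun _ : ℕ => Bool) i)
      exact h.mem_nhds rfl
    exact (Filter.eventually_all_finset _).2 this
  filter_upwards [this] with ω' h'
  exact h ω ω' (pre_congr fun i hi => (h' i (Finset.mem_range.2 hi)).symm) hω

/-- A partial computable function of strings that is defined on some prefix of every sequence has
a computable modulus and total computable values. -/
theorem exists_modulus {A : ℕ × List Bool →. ℤ} (hA : Partrec A)
    (hmono : ∀ n x y, x <+: y → (A (n, x)).Dom → (A (n, y)).Dom)
    (htot : ∀ n ω, ∃ l, (A (n, pre ω l)).Dom) :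
    ∃ (L : ℕ → ℕ) (g : ℕ × List Bool → ℤ), Computable L ∧ Computable g ∧
      ∀ n ω, g (n, pre ω (L n)) ∈ A (n, pre ω (L n)) := by
  obtain ⟨φ, hφ, hsound, hcompl⟩ := exists_stages hA
  let R : List Bool → ℕ × ℕ → Prop := fun x q => (φ (q.1, (q.2, x))).isSome = true
  have hR : PrimrecRel R := by
    refine PrimrecRel.comp (R := fun a b : Bool => a = b) Primrec.eq ?_ (Primrec.const true)
    exact Primrec.option_isSome.comp (hφ.comp ((Primrec.fst.comp Primrec.snd).pair
      ((Primrec.snd.comp Primrec.snd).pair Primrec.fst)))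
  have hR' := hR.forall_mem_list
  have hR'' : PrimrecRel fun n s : ℕ => ∀ x ∈ strings s.unpair.1, R x (s.unpair.2, n) :=
    hR'.comp₂ (primrec_strings.comp (Primrec.fst.comp (Primrec.unpair.comp Primrec.snd))).to₂
      ((Primrec.snd.comp (Primrec.unpair.comp Primrec.snd)).pair Primrec.fst).to₂
  classical
  -- The number `s` codes a length and a time bound; the test asks whether all strings of this
  -- length halt within this time.
  let test : ℕ → ℕ → Bool := fun n s => decide (∀ x ∈ strings s.unpair.1, R x (s.unpair.2, n))
  have htest : Computable₂ test := by
    exact (PrimrecRel.decide hR'').to_comp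
  have hex : ∀ n, ∃ s, test n s = true := by
    intro n
    -- The sets of sequences whose prefix of length `l` suffices are open and increase with `l`, so
    -- compactness gives one length for all sequences.
    obtain ⟨l, hl⟩ := isCompact_univ.elim_directed_cover
      (fun l => {ω : Cantor | (A (n, pre ω l)).Dom})
      (fun l => isOpen_of_pre l fun ω ω' h hω => by simpa [← h] using hω)
      (fun ω _ => by simpa using htot n ω)
      (directed_of_isDirected_le fun l l' h ω hω => hmono n _ _ (pre_prefix_pre ω h) hω)
    have hd : ∀ x ∈ strings l, (A (n, x)).Dom := by
      intro x hx
      have := hl (Set.mem_univ (ext x))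
      have h' := mem_cyl_iff.1 (mem_cyl_ext x)
      rw [mem_strings.1 hx] at h'
      simpa [h'] using this
    have ht : ∃ t, ∀ x ∈ (strings l).toFinset, (φ (t, (n, x))).isSome := by
      have : ∀ x ∈ (strings l).toFinset, ∀ᶠ t in atTop, (φ (t, (n, x))).isSome := fun x hx =>
        eventually_atTop.2 (hcompl _ (hd x (List.mem_toFinset.1 hx)))
      exact ((Filter.eventually_all_finset _).2 this).exists
    obtain ⟨t, ht⟩ := ht
    refine ⟨Nat.pair l t, ?_⟩
    simp only [test, R, Nat.unpair_pair, decide_eq_true_eq]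
    exact fun x hx => ht x (List.mem_toFinset.2 hx)
  let s : ℕ → ℕ := fun n => Nat.find (hex n)
  have hs : Computable s := by
    refine Partrec.of_eq_tot (Partrec.rfind htest.partrec₂) fun n => ?_
    refine Nat.mem_rfind.2 ⟨by simpa using (Nat.find_spec (hex n)).symm, fun {m} hm => ?_⟩
    have := Nat.find_min (hex n) hm
    simpa using this
  have hsp : Computable fun n => (s n).unpair := Computable.unpair.comp hs
  -- The default 0 is never used on strings of length `L n`, where the search has verified halting.
  refine ⟨fun n => (s n).unpair.1, fun q => (φ ((s q.1).unpair.2, q)).getD 0,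
    Computable.fst.comp hsp, ?_, fun n ω => ?_⟩
  · exact Computable.option_getD (hφ.to_comp.comp
      ((Computable.snd.comp (hsp.comp Computable.fst)).pair Computable.id)) (Computable.const 0)
  · have : test n (s n) = true := Nat.find_spec (hex n)
    simp only [test, R, decide_eq_true_eq] at this
    have h := this (pre ω (s n).unpair.1) (mem_strings.2 (by simp))
    obtain ⟨b, hb⟩ := Option.isSome_iff_exists.1 h
    refine hsound (s n).unpair.2 _ _ ?_
    change φ _ = some (Option.getD _ 0)
    rw [show φ ((s n).unpair.2, n, pre ω (s n).unpair.1) = some b from hb]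
    rfl

/-- A computable function is approximated with any precision by functions of a finite prefix of
the sequence; the length of this prefix and the approximations are computable. -/
theorem ComputableFunction.exists_approx {f : Cantor → ℝ} (hf : ComputableFunction f) :
    ∃ (L : ℕ → ℕ) (g : ℕ × List Bool → ℤ), Computable L ∧ Computable g ∧
      ∀ n ω, |f ω - g (n, pre ω (L n)) / 2 ^ n| ≤ 1 / 2 ^ n := by
  obtain ⟨M, hM, hf⟩ := hf
  have hA : Partrec fun q : ℕ × List Bool => (partialStep M).fix (q.2, (q.1, [])) :=
    (partrec_partialStep hM).fix.comp
      (Computable.snd.pair (Computable.fst.pair (Computable.const [])))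
  obtain ⟨L, g, hL, hg, h⟩ := exists_modulus hA
    (fun n x y hxy h => Part.dom_iff_mem.2 ⟨_, fix_partialStep_mono (Part.get_mem h) hxy⟩)
    (fun n ω => by
      obtain ⟨m, hm, -⟩ := hf ω n
      obtain ⟨l, hl⟩ := exists_fix_partialStep hm
      exact ⟨l, Part.dom_iff_mem.2 ⟨_, hl⟩⟩)
  refine ⟨L, g, hL, hg, fun n ω => ?_⟩
  obtain ⟨m, hm, hfm⟩ := hf ω n
  rwa [Part.mem_unique (oracleRun_of_partialStep (h n ω) (mem_cyl_pre ω _)) hm]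

/-! ### The upcrossing inequality for a single sequence. -/

/-- The number of alternations of the averages of `z` between values below `c` and values above
`c + 1`, counted greedily. -/
def crossings (c : ℕ) (z : ℕ → ℕ) : ℕ → ℕ
  | 0 => 0
  | n + 1 => crossings c z n +
      if (crossings c z n % 2 = 0 ∧ ∑ i ∈ Finset.range n, z i < c * n) ∨
        (crossings c z n % 2 = 1 ∧ (c + 1) * n < ∑ i ∈ Finset.range n, z i) then 1 else 0

theorem crossings_mono (c : ℕ) (z : ℕ → ℕ) : Monotone (crossings c z) :=
  monotone_nat_of_le_succ fun n => by simp [crossings]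

theorem crossings_congr {c : ℕ} {z z' : ℕ → ℕ} {n : ℕ} (h : ∀ i < n, z i = z' i) :
    crossings c z n = crossings c z' n := by
  induction n with
  | zero => rfl
  | succ n ih =>
    have hs : ∑ i ∈ Finset.range n, z i = ∑ i ∈ Finset.range n, z' i :=
      Finset.sum_congr rfl fun i hi => h i (by have := Finset.mem_range.1 hi; omega)
    simp only [crossings, ih fun i hi => h i (by omega), hs]

/-- The value `∑ (z i - c)` over `i ∈ e`, `i < N`, where each maximal run of `e` that ends with `i`
costs `i + 1`. -/
def gain (c : ℕ) (z : ℕ → ℕ) (N : ℕ) (e : Finset ℕ) : ℤ :=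
  ∑ i ∈ Finset.range N,
    ((if i ∈ e then (z i : ℤ) - c else 0) - if i ∈ e ∧ i + 1 ∉ e then (i + 1 : ℤ) else 0)

/-- The number of maximal runs of `e` that end before `N`. -/
def runs (e : Finset ℕ) (N : ℕ) : ℕ := ∑ i ∈ Finset.range N, if i ∈ e ∧ i + 1 ∉ e then 1 else 0

/-- The largest value of `gain`. -/
def maxGain (c : ℕ) (z : ℕ → ℕ) (N : ℕ) : ℤ :=
  (Finset.range N).powerset.sup' ⟨∅, by simp⟩ (gain c z N)

theorem gain_le_maxGain {c : ℕ} {z : ℕ → ℕ} {N : ℕ} {e : Finset ℕ} (he : e ⊆ Finset.range N) :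
    gain c z N e ≤ maxGain c z N :=
  Finset.le_sup' (gain c z N) (Finset.mem_powerset.2 he)

theorem exists_gain_eq_maxGain (c : ℕ) (z : ℕ → ℕ) (N : ℕ) :
    ∃ e ⊆ Finset.range N, gain c z N e = maxGain c z N := by
  obtain ⟨e, he, h⟩ := Finset.exists_mem_eq_sup' (s := (Finset.range N).powerset) ⟨∅, by simp⟩
    (gain c z N)
  exact ⟨e, Finset.mem_powerset.1 he, h.symm⟩

theorem maxGain_congr {c : ℕ} {z z' : ℕ → ℕ} {N : ℕ} (h : ∀ i < N, z i = z' i) :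
    maxGain c z N = maxGain c z' N := by
  have : gain c z N = gain c z' N := by
    funext e
    exact Finset.sum_congr rfl fun i hi => by rw [h i (Finset.mem_range.1 hi)]
  simp only [maxGain, this]

/-- Each run of `e` brings a gain when the sequence is shifted. -/
theorem gain_add_runs_le {c : ℕ} {z : ℕ → ℕ} {N : ℕ} {e : Finset ℕ} (he : e ⊆ Finset.range N) :
    gain c z N e + runs e N ≤ maxGain c (fun i => z (i + 1)) N + z 0 := by
  have hN : N ∉ e := fun h => by simpa using he h
  have hmem : ∀ i, i ∈ (Finset.range N).filter (· + 1 ∈ e) ↔ i + 1 ∈ e := by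
    intro i
    rw [Finset.mem_filter, Finset.mem_range, and_iff_right_iff_imp]
    exact fun h => by have := Finset.mem_range.1 (he h); omega
  have hle := gain_le_maxGain (c := c) (z := fun i => z (i + 1))
    (Finset.filter_subset (· + 1 ∈ e) (Finset.range N))
  -- The bonus 1 at the end of a run lowers its cost from `i + 1` to `i`, which is its cost after
  -- the shift; only the term at 0 is lost.
  let F : ℕ → ℤ := fun i =>
    (if i ∈ e then (z i : ℤ) - c else 0) - (if i ∈ e ∧ i + 1 ∉ e then (i + 1 : ℤ) else 0) +
      if i ∈ e ∧ i + 1 ∉ e then 1 else 0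
  have h₁ : gain c z N e + runs e N = ∑ i ∈ Finset.range (N + 1), F i := by
    rw [Finset.sum_range_succ]
    simp only [gain, runs, F, Finset.sum_add_distrib, hN]
    push_cast
    simp
  have h₂ : gain c (fun i => z (i + 1)) N ((Finset.range N).filter (· + 1 ∈ e)) =
      ∑ i ∈ Finset.range N, F (i + 1) := by
    refine Finset.sum_congr rfl fun i _ => ?_
    simp only [hmem, F]
    push_cast
    split_ifs <;> ring
  have h₃ : F 0 ≤ z 0 := by
    simp only [F]
    split_ifs <;> simp
  rw [h₁, Finset.sum_range_succ', ← h₂]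
  linarith

theorem sum_ite_Ico {s t N : ℕ} (hst : s ≤ t) (htN : t ≤ N) (w : ℕ → ℤ) :
    (∑ i ∈ Finset.range N, if i ∈ Finset.Ico s t then w i else 0) =
      ∑ i ∈ Finset.range t, w i - ∑ i ∈ Finset.range s, w i := by
  rw [← Finset.sum_filter, ← Finset.sum_Ico_eq_sub _ hst]
  congr 1
  ext i
  simp
  omega

theorem sum_ite_succ_eq_le (t N : ℕ) :
    (∑ i ∈ Finset.range N, if i + 1 = t then (t : ℤ) else 0) ≤ t := by
  rcases t with _ | t
  · simp
  · simp only [Nat.add_right_cancel_iff, Finset.sum_ite_eq']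
    split_ifs
    · exact le_rfl
    · positivity

/-- An optimal set meets each interval from a low average to a high average. -/
theorem exists_mem_of_low_high {c : ℕ} {z : ℕ → ℕ} {N : ℕ} {e : Finset ℕ}
    (he : e ⊆ Finset.range N) (hmax : gain c z N e = maxGain c z N) {s t : ℕ} (hst : s < t)
    (htN : t ≤ N) (hs : ∑ i ∈ Finset.range s, z i < c * s)
    (ht : (c + 1) * t < ∑ i ∈ Finset.range t, z i) : ∃ i, s ≤ i ∧ i < t ∧ i ∈ e := by
  by_contra! h
  have hsub : e ∪ Finset.Ico s t ⊆ Finset.range N :=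
    Finset.union_subset he fun i hi => by simp at hi ⊢; omega
  have hle := gain_le_maxGain (c := c) (z := z) hsub
  -- The only run end that can be new is `t - 1`, at cost `t`, whereas the interval itself earns
  -- more than `(c + 1) * t - c * t = t`.
  have hterm : gain c z N e + ((∑ i ∈ Finset.range N,
      if i ∈ Finset.Ico s t then (z i : ℤ) - c else 0) -
      ∑ i ∈ Finset.range N, if i + 1 = t then (t : ℤ) else 0) ≤
      gain c z N (e ∪ Finset.Ico s t) := by
    rw [← Finset.sum_sub_distrib]
    unfold gain
    rw [← Finset.sum_add_distrib]
    refine Finset.sum_le_sum fun i _ => ?_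
    have h₁ := h i
    have h₂ := h (i + 1)
    simp only [Finset.mem_union, Finset.mem_Ico]
    grind
  rw [sum_ite_Ico hst.le htN] at hterm
  have := sum_ite_succ_eq_le t N
  simp only [Finset.sum_sub_distrib, Finset.sum_const, Finset.card_range, nsmul_eq_mul] at hterm
  zify at hs ht
  nlinarith

/-- An optimal set does not contain an interval from a high average to a low average. -/
theorem exists_notMem_of_high_low {c : ℕ} {z : ℕ → ℕ} {N : ℕ} {e : Finset ℕ}
    (he : e ⊆ Finset.range N) (hmax : gain c z N e = maxGain c z N) {s t : ℕ} (hst : t < s)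
    (hsN : s ≤ N) (hs : ∑ i ∈ Finset.range s, z i < c * s)
    (ht : (c + 1) * t < ∑ i ∈ Finset.range t, z i) : ∃ i, t ≤ i ∧ i < s ∧ i ∉ e := by
  by_contra! h
  have hsub : e \ Finset.Ico t s ⊆ Finset.range N := Finset.sdiff_subset.trans he
  have hle := gain_le_maxGain (c := c) (z := z) hsub
  -- The only run end that can be new is again `t - 1`, at cost `t`, whereas the removed terms sum
  -- to less than `-t`.
  have hterm : gain c z N e - ((∑ i ∈ Finset.range N,
      if i ∈ Finset.Ico t s then (z i : ℤ) - c else 0) +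
      ∑ i ∈ Finset.range N, if i + 1 = t then (t : ℤ) else 0) ≤
      gain c z N (e \ Finset.Ico t s) := by
    rw [← Finset.sum_add_distrib]
    unfold gain
    rw [← Finset.sum_sub_distrib]
    refine Finset.sum_le_sum fun i _ => ?_
    have h₁ := h i
    have h₂ := h (i + 1)
    simp only [Finset.mem_sdiff, Finset.mem_Ico]
    grind
  rw [sum_ite_Ico hst.le hsN] at hterm
  have := sum_ite_succ_eq_le t N
  simp only [Finset.sum_sub_distrib, Finset.sum_const, Finset.card_range, nsmul_eq_mul] at hterm
  zify at hs ht
  nlinarith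

/-- The number of changes between `e` and its complement, up to the initial state; its parity tells
the membership in `e`. -/
def toggles (e : Finset ℕ) (n : ℕ) : ℕ := 2 * runs e n + if n ∈ e then 1 else 0

theorem toggles_mono (e : Finset ℕ) : Monotone (toggles e) := by
  refine monotone_nat_of_le_succ fun n => ?_
  simp only [toggles, runs, Finset.sum_range_succ]
  grind

/-- Here `τ` is the time of the last counted crossing, whose side is given by the parity of the
count. An optimal set has to be in the appropriate state somewhere between consecutive crossings;
the `+ 1` accounts for the first crossing, which forces nothing. -/
theorem le_toggles_of_crossings {c : ℕ} {z : ℕ → ℕ} {N : ℕ} {e : Finset ℕ}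
    (he : e ⊆ Finset.range N) (hmax : gain c z N e = maxGain c z N) {n : ℕ} (hn : n ≤ N + 1) :
    crossings c z n = 0 ∨ ∃ τ < n, ∃ i < τ, crossings c z n ≤ toggles e i + 1 ∧
      (crossings c z n % 2 = 1 → ∑ i ∈ Finset.range τ, z i < c * τ) ∧
      (crossings c z n % 2 = 0 → (c + 1) * τ < ∑ i ∈ Finset.range τ, z i) := by
  induction n with
  | zero => exact Or.inl rfl
  | succ n ih =>
    specialize ih (by omega)
    set m := crossings c z n with hm
    by_cases hstep : (m % 2 = 0 ∧ ∑ i ∈ Finset.range n, z i < c * n) ∨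
        (m % 2 = 1 ∧ (c + 1) * n < ∑ i ∈ Finset.range n, z i)
    · have hm' : crossings c z (n + 1) = m + 1 := by simp only [crossings, ← hm, if_pos hstep]
      rw [hm']
      refine Or.inr ⟨n, by omega, ?_⟩
      have hpos : 0 < n := by
        rcases Nat.eq_zero_or_pos n with rfl | h
        · simp at hstep
        · exact h
      suffices ∃ i < n, m ≤ toggles e i by
        obtain ⟨i, hi, hmi⟩ := this
        exact ⟨i, hi, by omega, fun h => (hstep.resolve_right fun h' => by omega).2,
          fun h => (hstep.resolve_left fun h' => by omega).2⟩
      rcases ih with h0 | ⟨τ, hτ, i, hi, hmi, hodd, heven⟩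
      · exact ⟨0, hpos, by omega⟩
      · rcases hstep with ⟨hp, hlow⟩ | ⟨hp, hhigh⟩
        · obtain ⟨j, hj, hjn, hje⟩ :=
            exists_notMem_of_high_low he hmax hτ (by omega) hlow (heven hp)
          have := toggles_mono e (hi.le.trans hj)
          -- Up to `j` there are at least `m - 1` toggles; their number has the parity of `m`, so it
          -- is at least `m`. The other case is the same with odd parity.
          have hj2 : toggles e j = 2 * runs e j := by simp [toggles, hje]
          exact ⟨j, hjn, by omega⟩
        · obtain ⟨j, hj, hjn, hje⟩ :=
            exists_mem_of_low_high he hmax hτ (by omega) (hodd hp) hhigh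
          have := toggles_mono e (hi.le.trans hj)
          have hj2 : toggles e j = 2 * runs e j + 1 := by simp [toggles, hje]
          exact ⟨j, hjn, by omega⟩
    · have hm' : crossings c z (n + 1) = m := by simp only [crossings, ← hm, if_neg hstep, add_zero]
      rw [hm']
      rcases ih with h0 | ⟨τ, hτ, h⟩
      · exact Or.inl h0
      · exact Or.inr ⟨τ, by omega, h⟩

/-- The upcrossing inequality before integration. -/
theorem upcrossing_le {c : ℕ} {z : ℕ → ℕ} {N K : ℕ} (h : 2 * K ≤ crossings c z N) :
    (K : ℤ) ≤ maxGain c (fun i => z (i + 1)) N - maxGain c z N + z 0 := by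
  obtain ⟨e, he, hmax⟩ := exists_gain_eq_maxGain c z N
  have key := gain_add_runs_le (c := c) (z := z) he
  suffices K ≤ runs e N by
    rw [hmax] at key
    zify at this
    linarith
  rcases le_toggles_of_crossings he hmax (Nat.le_succ N) with h0 | ⟨τ, hτ, i, hi, hmi, -, -⟩
  · omega
  · have := toggles_mono e (hi.trans hτ).le
    have hN : N ∉ e := fun h => by simpa using he h
    -- This number is even and at least `2 * K - 1`, hence at least `2 * K`.
    have hN2 : toggles e N = 2 * runs e N := by simp [toggles, hN]
    omega

/-! ### The upcrossing inequality for a stationary measure. -/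

/-- The values of `G` along the orbit of `ω` under the shift. -/
def orbit (G : Cantor → ℕ) (ω : Cantor) (i : ℕ) : ℕ := G (shift^[i] ω)

theorem shift_iterate_apply (ω : Cantor) (n i : ℕ) : shift^[n] ω i = ω (n + i) := by
  induction n generalizing ω i with
  | zero => simp
  | succ n ih =>
    rw [Function.iterate_succ_apply, ih]
    simp only [shift]
    congr 1
    omega

theorem orbit_congr {G : Cantor → ℕ} {l : ℕ} (hG : ∀ ω ω', pre ω l = pre ω' l → G ω = G ω')
    {ω ω' : Cantor} {N i : ℕ} (h : ∀ i < N + l, ω i = ω' i) (hi : i ≤ N) :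
    orbit G ω i = orbit G ω' i := by
  refine hG _ _ (pre_congr fun k hk => ?_)
  rw [shift_iterate_apply, shift_iterate_apply]
  exact h _ (by omega)

theorem integrable_of_finite_prefix {P : Measure Cantor} [IsFiniteMeasure P] {X : Cantor → ℝ} {l : ℕ}
    (h : ∀ ω ω', (∀ i < l, ω i = ω' i) → X ω = X ω') : Integrable X P := by
  let r : Cantor → (Fin l → Bool) := fun ω i => ω i
  let Y : (Fin l → Bool) → ℝ := fun y => X fun i => if hi : i < l then y ⟨i, hi⟩ else false
  have hXY : X = Y ∘ r := by
    funext ω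
    exact h _ _ fun i hi => by simp [r, hi]
  have hr : Measurable r := measurable_pi_lambda _ fun i => measurable_pi_apply _
  rw [hXY]
  exact (Integrable.of_finite (f := Y) (μ := P.map r)).comp_measurable hr

theorem measurableSet_of_finite_prefix {S : Set Cantor} {l : ℕ}
    (h : ∀ ω ω', (∀ i < l, ω i = ω' i) → (ω ∈ S → ω' ∈ S)) : MeasurableSet S := by
  let r : Cantor → (Fin l → Bool) := fun ω i => ω i
  have hr : Measurable r := measurable_pi_lambda _ fun i => measurable_pi_apply _
  have : S = r ⁻¹' (r '' S) := by
    refine (Set.subset_preimage_image r S).antisymm ?_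
    rintro ω ⟨ω', hω', hr'⟩
    exact h ω' ω (fun i hi => congrFun hr' ⟨i, hi⟩) hω'
  rw [this]
  exact hr (Set.Finite.measurableSet (Set.toFinite _))

/-- Integrating `upcrossing_le` gives this bound, because the optimal gain and its composition with
the shift have the same integral. -/
theorem measureReal_crossings_le {P : Measure Cantor} [IsProbabilityMeasure P]
    (hstat : MeasurePreserving shift P P) {G : Cantor → ℕ} {l B : ℕ}
    (hG : ∀ ω ω', pre ω l = pre ω' l → G ω = G ω') (hB : ∀ ω, G ω ≤ B) (c K N : ℕ) :
    K * P.real {ω | 2 * K ≤ crossings c (orbit G ω) N} ≤ B := by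
  let X : Cantor → ℝ := fun ω => maxGain c (orbit G ω) N
  have hX : Integrable X P := integrable_of_finite_prefix (l := N + l) fun ω ω' h => by
    simp only [X, maxGain_congr fun i hi => orbit_congr hG h hi.le]
  have hXs : Integrable (X ∘ shift) P := hstat.integrable_comp_of_integrable hX
  set S := {ω | 2 * K ≤ crossings c (orbit G ω) N}
  have hS : MeasurableSet S := measurableSet_of_finite_prefix (l := N + l) fun ω ω' h hω => by
    simpa only [S, Set.mem_ofPred_eq, crossings_congr fun i hi => orbit_congr hG h hi.le] using hω
  have hint : ∫ ω, X (shift ω) ∂P = ∫ ω, X ω ∂P := by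
    have hm := hX.aestronglyMeasurable
    rw [← hstat.map_eq] at hm
    rw [← integral_map hstat.measurable.aemeasurable hm, hstat.map_eq]
  have hle : ∀ ω, S.indicator (fun _ => (K : ℝ)) ω ≤ X (shift ω) - X ω + B := by
    intro ω
    have horb : orbit G (shift ω) = fun i => orbit G ω (i + 1) := rfl
    have h0 : (orbit G ω 0 : ℤ) ≤ B := by exact_mod_cast hB ω
    by_cases hω : ω ∈ S
    · rw [Set.indicator_of_mem hω]
      have h : (K : ℤ) ≤ maxGain c (orbit G (shift ω)) N - maxGain c (orbit G ω) N + B := by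
        rw [horb]
        linarith [upcrossing_le hω]
      simp only [X]
      exact_mod_cast h
    -- Outside `S` nonnegativity is needed, which is the upcrossing inequality with `K = 0`.
    · rw [Set.indicator_of_notMem hω]
      have h : 0 ≤ maxGain c (orbit G (shift ω)) N - maxGain c (orbit G ω) N + B := by
        rw [horb]
        have := upcrossing_le (c := c) (z := orbit G ω) (N := N) (K := 0) (by simp)
        push_cast at this
        linarith
      simp only [X]
      exact_mod_cast h
  have := integral_mono ((integrable_const (K : ℝ)).indicator hS)
    ((hXs.sub hX).add (integrable_const (B : ℝ))) hle
  rw [integral_indicator_const _ hS] at this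
  rw [integral_add' (hXs.sub hX) (integrable_const _), integral_sub' hXs hX] at this
  simpa [hint, mul_comm] using this

/-- The probability of many crossings is small. -/
theorem measure_crossings_le {P : Measure Cantor} [IsProbabilityMeasure P]
    (hstat : MeasurePreserving shift P P) {G : Cantor → ℕ} {l B : ℕ}
    (hG : ∀ ω ω', pre ω l = pre ω' l → G ω = G ω') (hB : ∀ ω, G ω ≤ B) (hB0 : 0 < B) (c q : ℕ) :
    P {ω | ∃ N, 2 * (2 ^ q * B) ≤ crossings c (orbit G ω) N} ≤ (2 ^ q)⁻¹ := by
  have hU : {ω | ∃ N, 2 * (2 ^ q * B) ≤ crossings c (orbit G ω) N} =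
      ⋃ N, {ω | 2 * (2 ^ q * B) ≤ crossings c (orbit G ω) N} := by ext; simp
  have hmono : Monotone fun N => {ω | 2 * (2 ^ q * B) ≤ crossings c (orbit G ω) N} :=
    fun N N' h ω hω => le_trans hω (crossings_mono _ _ h)
  rw [hU, hmono.measure_iUnion]
  refine iSup_le fun N => ?_
  have h := measureReal_crossings_le hstat hG hB c (2 ^ q * B) N
  have hBr : (0 : ℝ) < B := by exact_mod_cast hB0
  have h' : P.real {ω | 2 * (2 ^ q * B) ≤ crossings c (orbit G ω) N} ≤ (2 ^ q)⁻¹ := by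
    rw [← one_div, le_div_iff₀ (by positivity)]
    push_cast at h
    have : (B : ℝ) * (P.real {ω | 2 * (2 ^ q * B) ≤ crossings c (orbit G ω) N} * 2 ^ q) ≤ B * 1 := by
      linarith
    exact le_of_mul_le_mul_left this hBr
  rw [← ENNReal.ofReal_toReal (measure_ne_top P _)]
  refine (ENNReal.ofReal_le_ofReal h').trans_eq ?_
  rw [ENNReal.ofReal_inv_of_pos (by positivity), ENNReal.ofReal_pow (by norm_num)]
  norm_num

/-! ### Natural-valued approximations and computability of crossing counts. -/

theorem encode_int_natCast (n : ℕ) : Encodable.encode (n : ℤ) = 2 * n := rfl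

theorem encode_int_negSucc (n : ℕ) : Encodable.encode (Int.negSucc n) = 2 * n + 1 := rfl

/-- The computation is done on codes: `n` is coded by `2 * n` and `-(n + 1)` by `2 * n + 1`, so
parity gives the sign. -/
theorem primrec_add_toNat : Primrec₂ fun (m : ℤ) (b : ℕ) => (m + b).toNat := by
  have he : Primrec fun q : ℤ × ℕ => Encodable.encode q.1 := Primrec.encode.comp Primrec.fst
  have hd : Primrec fun q : ℤ × ℕ => Encodable.encode q.1 / 2 :=
    Primrec.nat_div.comp he (Primrec.const 2)
  have h : Primrec fun q : ℤ × ℕ => if Encodable.encode q.1 % 2 = 0 then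
      Encodable.encode q.1 / 2 + q.2 else q.2 - (Encodable.encode q.1 / 2 + 1) :=
    Primrec.ite (Primrec.eq.comp (Primrec.nat_mod.comp he (Primrec.const 2)) (Primrec.const 0))
      (Primrec.nat_add.comp hd Primrec.snd)
      (Primrec.nat_sub.comp Primrec.snd (Primrec.succ.comp hd))
  refine h.of_eq ?_
  rintro ⟨m | m, b⟩
  · simp [encode_int_natCast]
    omega
  · have : (2 * m + 1) / 2 = m := by omega
    simp [encode_int_negSucc, this, Nat.add_mod]
    omega

theorem primrec_two_pow : Primrec fun n : ℕ => 2 ^ n :=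
  (Primrec.nat_rec₁ 1 (f := fun _ m => 2 * m)
    (Primrec.nat_mul.comp (Primrec.const 2) Primrec.snd).to₂).of_eq fun n => by
      induction n with
      | zero => rfl
      | succ n ih => simp only [pow_succ, ← ih, mul_comm]

/-- A computable function is bounded and, after adding a constant and scaling, it is approximated by
natural-valued computable functions of a finite prefix. -/
theorem ComputableFunction.exists_nat_approx {f : Cantor → ℝ} (hf : ComputableFunction f) :
    ∃ (C : ℕ) (L : ℕ → ℕ) (g : ℕ × List Bool → ℕ), Computable L ∧ Computable g ∧
      (∀ ω, |f ω| ≤ C) ∧ ∀ p ω, |2 ^ p * (f ω + C) - g (p, pre ω (L p))| ≤ 1 := by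
  obtain ⟨L, g, hL, hg, h⟩ := hf.exists_approx
  obtain ⟨C, hC⟩ : ∃ C : ℕ, ∀ ω, |f ω| ≤ C := by
    -- At precision 0 the approximation takes finitely many values and has error at most 1.
    obtain ⟨D, hD⟩ := ((strings (L 0)).toFinset.image fun x => |g (0, x)|).bddAbove
    obtain ⟨C, hC⟩ := exists_nat_ge ((D : ℝ) + 1)
    refine ⟨C, fun ω => le_trans ?_ hC⟩
    have h₁ : |g (0, pre ω (L 0))| ≤ D := hD (by
      simp only [Finset.coe_image, Set.mem_image, Finset.mem_coe, List.mem_toFinset]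
      exact ⟨_, mem_strings.2 (length_pre _ _), rfl⟩)
    have h₂ : |(g (0, pre ω (L 0)) : ℝ)| ≤ D := by exact_mod_cast h₁
    have h₃ := h 0 ω
    simp only [pow_zero, div_one] at h₃
    have := abs_add_le (f ω - g (0, pre ω (L 0))) (g (0, pre ω (L 0)))
    rw [sub_add_cancel] at this
    linarith
  refine ⟨C, L, fun q => (g q + (C * 2 ^ q.1 : ℕ)).toNat, hL, ?_, hC, fun p ω => ?_⟩
  · exact primrec_add_toNat.to_comp.comp hg (Primrec.nat_mul.comp (Primrec.const C)
      (primrec_two_pow.comp Primrec.fst)).to_comp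
  · have h₁ := h p ω
    set m := g (p, pre ω (L p))
    have hp : (0 : ℝ) < 2 ^ p := by positivity
    have h₂ : |2 ^ p * f ω - m| ≤ 1 := by
      have : 2 ^ p * f ω - m = 2 ^ p * (f ω - m / 2 ^ p) := by field_simp
      rw [this, abs_mul, abs_of_pos hp]
      calc 2 ^ p * |f ω - m / 2 ^ p| ≤ 2 ^ p * (1 / 2 ^ p) := by gcongr
        _ = 1 := by field_simp
    -- The approximated quantity is nonnegative, so truncating the approximation at 0 does not
    -- increase the error beyond 1.
    have h₃ : 0 ≤ 2 ^ p * (f ω + C) := mul_nonneg hp.le (by linarith [(abs_le.1 (hC ω)).1])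
    have h₄ : (((m + (C * 2 ^ p : ℕ)).toNat : ℕ) : ℝ) = max ((m : ℝ) + C * 2 ^ p) 0 := by
      have : (((m + (C * 2 ^ p : ℕ)).toNat : ℕ) : ℤ) = max (m + C * 2 ^ p) 0 := by
        rw [Int.toNat_eq_max]
        push_cast
        rfl
      exact_mod_cast congrArg (Int.cast : ℤ → ℝ) this
    rw [h₄]
    rw [abs_le] at h₂ ⊢
    rcases max_cases ((m : ℝ) + C * 2 ^ p) 0 with ⟨h₅, h₆⟩ | ⟨h₅, h₆⟩ <;> rw [h₅] <;>
      constructor <;> nlinarith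

theorem computable_sum {α : Type*} [Primcodable α] {z : α → ℕ → ℕ} (hz : Computable₂ z) :
    Computable₂ fun a n => ∑ i ∈ Finset.range n, z a i := by
  have h : Computable fun q : α × ℕ =>
      Nat.rec (motive := fun _ => ℕ) 0 (fun i s => s + z q.1 i) q.2 :=
    Computable.nat_rec Computable.snd (Computable.const 0)
      (Primrec.nat_add.to_comp.comp (Computable.snd.comp Computable.snd)
        (hz.comp (Computable.fst.comp Computable.fst) (Computable.fst.comp Computable.snd))).to₂
  refine h.of_eq fun ⟨a, n⟩ => ?_
  induction n with
  | zero => rfl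
  | succ n ih => simp only [Finset.sum_range_succ, ← ih]

theorem computable_crossings {α : Type*} [Primcodable α] {c : α → ℕ} {z : α → ℕ → ℕ}
    (hc : Computable c) (hz : Computable₂ z) :
    Computable₂ fun a n => crossings (c a) (z a) n := by
  have hstep : Primrec fun q : (ℕ × ℕ) × (ℕ × ℕ) => q.2.2 +
      if (q.2.2 % 2 = 0 ∧ q.2.1 < q.1.1 * q.1.2) ∨
        (q.2.2 % 2 = 1 ∧ (q.1.1 + 1) * q.1.2 < q.2.1) then 1 else 0 := by
    have hm : Primrec fun q : (ℕ × ℕ) × (ℕ × ℕ) => q.2.2 := Primrec.snd.comp Primrec.snd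
    have hs : Primrec fun q : (ℕ × ℕ) × (ℕ × ℕ) => q.2.1 := Primrec.fst.comp Primrec.snd
    have hc : Primrec fun q : (ℕ × ℕ) × (ℕ × ℕ) => q.1.1 := Primrec.fst.comp Primrec.fst
    have hn : Primrec fun q : (ℕ × ℕ) × (ℕ × ℕ) => q.1.2 := Primrec.snd.comp Primrec.fst
    have h2 := Primrec.nat_mod.comp hm (Primrec.const 2)
    exact Primrec.nat_add.comp hm (Primrec.ite
      (((Primrec.eq.comp h2 (Primrec.const 0)).and (Primrec.nat_lt.comp hs
        (Primrec.nat_mul.comp hc hn))).or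
        ((Primrec.eq.comp h2 (Primrec.const 1)).and (Primrec.nat_lt.comp
          (Primrec.nat_mul.comp (Primrec.succ.comp hc) hn) hs)))
      (Primrec.const 1) (Primrec.const 0))
  have hsum := computable_sum hz
  have ha : Computable fun q : (α × ℕ) × (ℕ × ℕ) => q.1.1 := Computable.fst.comp Computable.fst
  have hn : Computable fun q : (α × ℕ) × (ℕ × ℕ) => q.2.1 := Computable.fst.comp Computable.snd
  have h := Computable.nat_rec (f := fun q : α × ℕ => q.2) (g := fun _ => 0) Computable.snd
    (Computable.const 0) (hstep.to_comp.comp (((hc.comp ha).pair hn).pair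
      ((hsum.comp ha hn).pair (Computable.snd.comp Computable.snd)))).to₂
  refine h.of_eq fun ⟨a, n⟩ => ?_
  induction n with
  | zero => rfl
  | succ n ih =>
    simp only [crossings, ← ih]

theorem computable_exists_lt {α : Type*} [Primcodable α] {p : α → ℕ → Prop}
    [∀ a, DecidablePred (p a)] (hp : Computable₂ fun a j => decide (p a j)) :
    Computable₂ fun a n => decide (∃ j < n, p a j) := by
  have h : Computable fun q : α × ℕ =>
      Nat.rec (motive := fun _ => Bool) false (fun j b => b || decide (p q.1 j)) q.2 :=
    Computable.nat_rec Computable.snd (Computable.const false)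
      (Primrec.or.to_comp.comp (Computable.snd.comp Computable.snd)
        (hp.comp (Computable.fst.comp Computable.fst) (Computable.fst.comp Computable.snd))).to₂
  refine h.of_eq fun ⟨a, n⟩ => ?_
  induction n with
  | zero => simp
  | succ n ih =>
    simp only [Nat.exists_lt_succ_right, Bool.decide_or, ← ih]

theorem computable_pre_shift_ext {α : Type*} [Primcodable α] {x : α → List Bool} {i l : α → ℕ}
    (hx : Computable x) (hi : Computable i) (hl : Computable l) :
    Computable fun a => pre (shift^[i a] (ext (x a))) (l a) := by
  have h : Primrec fun q : (List Bool × ℕ) × ℕ =>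
      (List.range q.2).map fun i => q.1.1.getD (q.1.2 + i) false :=
    Primrec.list_map (Primrec.list_range.comp Primrec.snd)
      ((Primrec.list_getD false).comp (Primrec.fst.comp (Primrec.fst.comp Primrec.fst))
        (Primrec.nat_add.comp (Primrec.snd.comp (Primrec.fst.comp Primrec.fst)) Primrec.snd)).to₂
  refine (h.to_comp.comp ((hx.pair hi).pair hl)).of_eq fun a => List.map_congr_left fun k _ => ?_
  rw [shift_iterate_apply]
  rfl

/-! ### From decidable prefix tests to effectively null sets. -/

/-- A set is effectively null if it is covered by open sets of small measure that are
enumerated by a decidable, increasing condition on prefixes. -/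
theorem effectivelyNull_of_prefix_tests {P : Measure Cantor} {E : ℕ → Cantor → ℕ → Prop}
    (hE : ComputablePred fun q : (ℕ × List Bool) × ℕ => E q.1.1 (ext q.1.2) q.2)
    (hpre : ∀ {k ω ω' l}, pre ω l = pre ω' l → E k ω l → E k ω' l)
    (hmono : ∀ {k ω l l'}, l ≤ l' → E k ω l → E k ω l') (hzero : ∀ k ω, ¬ E k ω 0) {A : Set Cantor}
    (hA : ∀ ω ∈ A, ∀ k, ∃ l, E k ω l) (hP : ∀ k, P {ω | ∃ l, E k ω l} ≤ (2 ^ k)⁻¹) :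
    EffectivelyNull P A := by
  have hext : ∀ {k x l ω}, ω ∈ cyl x → l ≤ x.length → E k (ext x) l → E k ω l := by
    intro k x l ω hω hl
    refine hpre (pre_congr fun i hi => ?_)
    rw [mem_cyl_ext x i (by omega), hω i (by omega)]
  have hext' : ∀ {k x l ω}, ω ∈ cyl x → l ≤ x.length → E k ω l → E k (ext x) l := by
    intro k x l ω hω hl
    refine hpre (pre_congr fun i hi => ?_)
    rw [mem_cyl_ext x i (by omega), hω i (by omega)]
  -- These are the shortest prefixes that pass the test. No two distinct ones are comparable, so the
  -- sum of their measures is the measure of the union.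
  let U : ℕ → Set (List Bool) := fun k =>
    {x | E k (ext x) x.length ∧ ¬ E k (ext x) (x.length - 1)}
  have hlt : ∀ {k x l ω}, x ∈ U k → ω ∈ cyl x → E k ω l → x.length ≤ l := by
    intro k x l ω hx hω hl
    by_contra hlx
    exact hx.2 (hext' hω (Nat.sub_le _ _) (hmono (by omega) hl))
  refine ⟨U, ?_, fun k => ⟨fun ω hω => ?_, ?_⟩⟩
  · obtain ⟨hdec, hcomp⟩ := hE
    have hlen : Computable fun q : ℕ × List Bool => q.2.length :=
      Computable.list_length.comp Computable.snd
    refine ComputablePred.to_re ⟨fun q => @instDecidableAnd _ _ (hdec (q, q.2.length))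
      (@instDecidableNot _ (hdec (q, q.2.length - 1))), ?_⟩
    refine (Primrec.and.to_comp.comp (hcomp.comp (Computable.id.pair hlen))
      (Primrec.not.to_comp.comp (hcomp.comp (Computable.id.pair
        (Computable.pred.comp hlen))))).of_eq fun q => ?_
    rw [Bool.eq_iff_iff]
    simp [U]
  · classical
    have hex := hA ω hω k
    refine Set.mem_iUnion₂.2 ⟨pre ω (Nat.find hex), ⟨?_, fun h => ?_⟩, mem_cyl_pre ω _⟩
    · exact hext' (mem_cyl_pre ω _) le_rfl (by simpa using Nat.find_spec hex)
    · have h := hext (mem_cyl_pre ω _) (Nat.sub_le _ _) h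
      rw [length_pre] at h
      rcases Nat.eq_zero_or_pos (Nat.find hex) with h0 | h0
      · rw [h0] at h
        exact hzero _ _ h
      · exact Nat.find_min hex (by omega) h
  · have hdisj : Pairwise (Function.onFun Disjoint fun x : U k => cyl (x : List Bool)) := by
      intro x y hxy
      refine Set.disjoint_left.2 fun ω hx hy => hxy (Subtype.ext ?_)
      have h₁ := hlt x.2 hx (hext hy le_rfl y.2.1)
      have h₂ := hlt y.2 hy (hext hx le_rfl x.2.1)
      rw [← mem_cyl_iff.1 hx, ← mem_cyl_iff.1 hy, le_antisymm h₁ h₂]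
    rw [← measure_iUnion hdisj fun x => measurableSet_of_finite_prefix
      (l := (x : List Bool).length) fun ω ω' h hω i hi => by rw [← h i hi, hω i hi]]
    refine (measure_mono (Set.iUnion_subset fun x ω hω => ?_)).trans (hP k)
    exact ⟨_, hext hω le_rfl x.2.1⟩

/-! ### Divergence forces unboundedly many crossings. -/

/-- The parity of the current count tells which side is awaited, and both sides recur arbitrarily
late. -/
theorem crossings_unbounded {c : ℕ} {z : ℕ → ℕ}
    (hlow : ∃ᶠ n in atTop, ∑ i ∈ Finset.range n, z i < c * n)
    (hhigh : ∃ᶠ n in atTop, (c + 1) * n < ∑ i ∈ Finset.range n, z i) (m : ℕ) :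
    ∃ N, m ≤ crossings c z N := by
  induction m with
  | zero => exact ⟨0, Nat.zero_le _⟩
  | succ m ih =>
    obtain ⟨N, hN⟩ := ih
    rcases Nat.mod_two_eq_zero_or_one m with hm | hm
    · obtain ⟨n, hn, h⟩ := frequently_atTop.1 hlow N
      have := crossings_mono c z hn
      rcases Nat.lt_or_ge m (crossings c z n) with h' | h'
      · exact ⟨n, h'⟩
      · have he : crossings c z n = m := by omega
        exact ⟨n + 1, by simp [crossings, he, hm, h]⟩
    · obtain ⟨n, hn, h⟩ := frequently_atTop.1 hhigh N
      have := crossings_mono c z hn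
      rcases Nat.lt_or_ge m (crossings c z n) with h' | h'
      · exact ⟨n, h'⟩
      · have he : crossings c z n = m := by omega
        exact ⟨n + 1, by simp [crossings, he, hm, h]⟩

theorem abs_birkhoffAverage_le {f : Cantor → ℝ} {C : ℝ} (hC : ∀ ω, |f ω| ≤ C) (n : ℕ) (ω : Cantor) :
    |birkhoffAverage ℝ shift f n ω| ≤ C := by
  have hC0 : 0 ≤ C := (abs_nonneg _).trans (hC ω)
  rw [birkhoffAverage, birkhoffSum, smul_eq_mul, abs_mul, abs_inv, Nat.abs_cast]
  have : |∑ k ∈ Finset.range n, f (shift^[k] ω)| ≤ n * C := by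
    refine (Finset.abs_sum_le_sum_abs _ _).trans ((Finset.sum_le_sum fun k _ => hC _).trans ?_)
    simp
  rcases Nat.eq_zero_or_pos n with rfl | hn
  · simpa using hC0
  · have hn' : (0 : ℝ) < n := by exact_mod_cast hn
    rw [inv_mul_le_iff₀ hn']
    exact this

/-- If the averages of `f` along the orbit diverge, then the averages of a sufficiently precise
integer-valued approximation cross some interval infinitely often. -/
theorem exists_crossings_unbounded {f : Cantor → ℝ} {C : ℕ} {G : ℕ → Cantor → ℕ}
    (hC : ∀ ω, |f ω| ≤ C) (hG : ∀ p ω, |2 ^ p * (f ω + C) - G p ω| ≤ 1) {ω : Cantor}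
    (hω : ¬ HasOrbitAverage f ω) :
    ∃ p c, ∀ m, ∃ N, m ≤ crossings c (orbit (G p) ω) N := by
  obtain ⟨a, b, hab, hlow, hhigh⟩ : ∃ a b : ℝ, a < b ∧
      (∃ᶠ n in atTop, birkhoffAverage ℝ shift f n ω < a) ∧
      ∃ᶠ n in atTop, b < birkhoffAverage ℝ shift f n ω := by
    by_contra! h
    refine hω (tendsto_of_no_upcrossings dense_univ
      (fun a _ b _ hab hh => hh.2 ((h a b hab hh.1).mono fun n => not_lt_of_ge)) ?_ ?_)
    · exact isBoundedUnder_of ⟨C, fun n => (abs_le.1 (abs_birkhoffAverage_le hC n ω)).2⟩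
    · exact isBoundedUnder_of ⟨-C, fun n => (abs_le.1 (abs_birkhoffAverage_le hC n ω)).1⟩
  have haC : 0 < a + C := by
    obtain ⟨n, hn⟩ := hlow.exists
    have := (abs_le.1 (abs_birkhoffAverage_le hC n ω)).1
    linarith
  -- The scaled gap must exceed 4: an error of 1 at each end, at most 1 for rounding up to `c`, and
  -- 1 for the distance from `c` to `c + 1`.
  obtain ⟨p, hp⟩ := pow_unbounded_of_one_lt (4 / (b - a)) (one_lt_two (α := ℝ))
  rw [div_lt_iff₀ (by linarith)] at hp
  have hp0 : (0 : ℝ) < 2 ^ p := by positivity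
  have hc₁ := Nat.le_ceil (2 ^ p * (a + C) + 1)
  have hc₂ := Nat.ceil_lt_add_one (a := 2 ^ p * (a + C) + 1) (by positivity)
  set c := ⌈2 ^ p * (a + C) + 1⌉₊
  have hsum : ∀ n : ℕ, |2 ^ p * (∑ i ∈ Finset.range n, f (shift^[i] ω) + n * C) -
      (∑ i ∈ Finset.range n, orbit (G p) ω i : ℕ)| ≤ n := by
    intro n
    have h : 2 ^ p * (∑ i ∈ Finset.range n, f (shift^[i] ω) + n * C) -
        (∑ i ∈ Finset.range n, orbit (G p) ω i : ℕ) =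
        ∑ i ∈ Finset.range n, (2 ^ p * (f (shift^[i] ω) + C) - G p (shift^[i] ω)) := by
      rw [Finset.sum_sub_distrib, ← Finset.mul_sum, Finset.sum_add_distrib]
      simp [orbit]
    rw [h]
    refine (Finset.abs_sum_le_sum_abs _ _).trans ((Finset.sum_le_sum fun i _ => hG p _).trans ?_)
    simp
  have havg : ∀ n : ℕ, 0 < n → birkhoffAverage ℝ shift f n ω * n =
      ∑ i ∈ Finset.range n, f (shift^[i] ω) := by
    intro n hn
    have hn' : (n : ℝ) ≠ 0 := by exact_mod_cast hn.ne'
    rw [birkhoffAverage, birkhoffSum, smul_eq_mul]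
    field_simp
  refine ⟨p, c, crossings_unbounded ?_ ?_⟩
  · refine (hlow.and_eventually (eventually_gt_atTop 0)).mono fun n ⟨h, hn⟩ => ?_
    have hn' : (0 : ℝ) < n := by exact_mod_cast hn
    have h₁ := (abs_le.1 (hsum n)).1
    rw [← havg n hn] at h₁
    have h₂ : ((∑ i ∈ Finset.range n, orbit (G p) ω i : ℕ) : ℝ) < c * n := by
      calc ((∑ i ∈ Finset.range n, orbit (G p) ω i : ℕ) : ℝ)
          ≤ (2 ^ p * (birkhoffAverage ℝ shift f n ω + C) + 1) * n := by linarith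
        _ < (2 ^ p * (a + C) + 1) * n := by gcongr
        _ ≤ c * n := by gcongr
    exact_mod_cast h₂
  · refine (hhigh.and_eventually (eventually_gt_atTop 0)).mono fun n ⟨h, hn⟩ => ?_
    have hn' : (0 : ℝ) < n := by exact_mod_cast hn
    have h₁ := (abs_le.1 (hsum n)).2
    rw [← havg n hn] at h₁
    have h₂ : (c + 1) * n < ((∑ i ∈ Finset.range n, orbit (G p) ω i : ℕ) : ℝ) := by
      calc ((c : ℝ) + 1) * n < (2 ^ p * (b + C) - 1) * n := by
            gcongr
            linarith
        _ ≤ (2 ^ p * (birkhoffAverage ℝ shift f n ω + C) - 1) * n := by gcongr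
        _ ≤ ((∑ i ∈ Finset.range n, orbit (G p) ω i : ℕ) : ℝ) := by linarith
    exact_mod_cast h₂

/-! ### The test that captures all divergent orbits. -/

theorem tsum_inv_two_pow_add (k : ℕ) :
    ∑' j : ℕ, ((2 : ENNReal) ^ (k + j + 1))⁻¹ = (2 ^ k)⁻¹ := by
  have : ∀ j : ℕ, ((2 : ENNReal) ^ (k + j + 1))⁻¹ = 2⁻¹ ^ k * 2⁻¹ ^ (j + 1) := fun j => by
    rw [ENNReal.inv_pow, add_assoc, pow_add]
  simp_rw [this]
  rw [ENNReal.tsum_mul_left, ENNReal.tsum_geometric_add_one, ← ENNReal.inv_pow,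
    ENNReal.one_sub_inv_two, inv_inv, ENNReal.inv_mul_cancel two_ne_zero ENNReal.ofNat_ne_top,
    mul_one]

/-- The `j`-th pair of thresholds is crossed often enough for level `k` by the averages of the `j`-th
approximation, as witnessed by the first `l` terms of `ω`. -/
def CrossingTest (C : ℕ) (L : ℕ → ℕ) (g : ℕ × List Bool → ℕ) (k : ℕ) (ω : Cantor) (l j : ℕ) : Prop :=
  2 * (2 ^ (k + j + 1) * (2 ^ j.unpair.1 * (2 * C) + 1)) ≤
    crossings j.unpair.2 (orbit (fun ω => g (j.unpair.1, pre ω (L j.unpair.1))) ω)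
      (l - L j.unpair.1)

theorem computable_crossings_orbit {α : Type*} [Primcodable α] {L : ℕ → ℕ}
    {g : ℕ × List Bool → ℕ} (hL : Computable L) (hg : Computable g) {x : α → List Bool}
    {p c n : α → ℕ} (hx : Computable x) (hp : Computable p) (hc : Computable c)
    (hn : Computable n) :
    Computable fun a =>
      crossings (c a) (orbit (fun ω => g (p a, pre ω (L (p a)))) (ext (x a))) (n a) := by
  have hp' : Computable fun r : α × ℕ => p r.1 := hp.comp Computable.fst
  have hz : Computable₂ fun (a : α) (i : ℕ) => g (p a, pre (shift^[i] (ext (x a))) (L (p a))) :=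
    (hg.comp (hp'.pair (computable_pre_shift_ext (hx.comp Computable.fst) Computable.snd
      (hL.comp hp')))).to₂
  exact (computable_crossings hc hz).comp Computable.id hn

theorem primrec_crossing_threshold (C : ℕ) : Primrec fun q : (ℕ × ℕ) × ℕ =>
    2 * (2 ^ (q.1.1 + q.1.2 + 1) * (2 ^ q.2 * (2 * C) + 1)) :=
  Primrec.nat_mul.comp (Primrec.const 2) (Primrec.nat_mul.comp
    (primrec_two_pow.comp (Primrec.succ.comp (Primrec.nat_add.comp
      (Primrec.fst.comp Primrec.fst) (Primrec.snd.comp Primrec.fst))))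
    (Primrec.succ.comp (Primrec.nat_mul.comp (primrec_two_pow.comp Primrec.snd)
      (Primrec.const (2 * C)))))

theorem computable_crossingTest (C : ℕ) {α : Type*} [Primcodable α] {L : ℕ → ℕ}
    {g : ℕ × List Bool → ℕ} (hL : Computable L) (hg : Computable g) {x : α → List Bool}
    {k l j : α → ℕ} (hk : Computable k) (hx : Computable x) (hl : Computable l)
    (hj : Computable j) [∀ a, Decidable (CrossingTest C L g (k a) (ext (x a)) (l a) (j a))] :
    Computable fun a => decide (CrossingTest C L g (k a) (ext (x a)) (l a) (j a)) := by
  have hp : Computable fun a => (j a).unpair.1 :=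
    Computable.fst.comp (Computable.unpair.comp hj)
  have hc : Computable fun a => (j a).unpair.2 :=
    Computable.snd.comp (Computable.unpair.comp hj)
  have hn : Computable fun a => l a - L (j a).unpair.1 :=
    Primrec.nat_sub.to_comp.comp hl (hL.comp hp)
  have hthr := (primrec_crossing_threshold C).to_comp.comp ((hk.pair hj).pair hp)
  have hle : Computable₂ fun a b : ℕ => decide (a ≤ b) :=
    (PrimrecRel.decide Primrec.nat_le).to_comp
  refine (hle.comp hthr (computable_crossings_orbit hL hg hx hp hc hn)).of_eq fun a => ?_
  rw [Bool.eq_iff_iff, decide_eq_true_eq, decide_eq_true_eq]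
  rfl

theorem computablePred_crossingTest (C : ℕ) {L : ℕ → ℕ} {g : ℕ × List Bool → ℕ}
    (hL : Computable L) (hg : Computable g) :
    ComputablePred fun q : (ℕ × List Bool) × ℕ =>
      ∃ j < q.2, CrossingTest C L g q.1.1 (ext q.1.2) q.2 j := by
  classical
  have hD : Computable₂ fun (q : (ℕ × List Bool) × ℕ) (j : ℕ) =>
      decide (CrossingTest C L g q.1.1 (ext q.1.2) q.2 j) :=
    (computable_crossingTest C hL hg (Computable.fst.comp (Computable.fst.comp Computable.fst))
      (Computable.snd.comp (Computable.fst.comp Computable.fst))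
      (Computable.snd.comp Computable.fst) Computable.snd).to₂
  exact ⟨fun q => inferInstance, (computable_exists_lt hD).comp Computable.id Computable.snd⟩

/-- The set of sequences along whose orbit the averages of a computable function diverge is
effectively null. -/
theorem ComputableFunction.effectivelyNull_not_hasOrbitAverage {P : Measure Cantor}
    [IsProbabilityMeasure P] (hstat : MeasurePreserving shift P P) {f : Cantor → ℝ}
    (hf : ComputableFunction f) : EffectivelyNull P {ω | ¬ HasOrbitAverage f ω} := by
  obtain ⟨C, L, g, hL, hg, hC, happrox⟩ := hf.exists_nat_approx
  let G : ℕ → Cantor → ℕ := fun p ω => g (p, pre ω (L p))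
  -- Since `f ω + C ≤ 2 * C`, this bounds the approximation with its error 1, and it is positive
  -- even if `C = 0`.
  let B : ℕ → ℕ := fun p => 2 ^ p * (2 * C) + 1
  have hGpre : ∀ p ω ω', pre ω (L p) = pre ω' (L p) → G p ω = G p ω' := fun p ω ω' h => by
    simp only [G, h]
  have hGB : ∀ p ω, G p ω ≤ B p := by
    intro p ω
    have h₁ := (abs_le.1 (happrox p ω)).1
    have h₂ : 2 ^ p * (f ω + C) ≤ 2 ^ p * (2 * C) := by
      gcongr
      linarith [(abs_le.1 (hC ω)).2]
    have : (G p ω : ℝ) ≤ B p := by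
      simp only [G, B]
      push_cast
      linarith
    exact_mod_cast this
  -- The bound `j < l` makes the search finite and the test false at `l = 0`, and still lets every
  -- `j` be reached.
  refine effectivelyNull_of_prefix_tests (E := fun k ω l => ∃ j < l, CrossingTest C L g k ω l j)
    (computablePred_crossingTest C hL hg) ?_ ?_ ?_ ?_ ?_
  · rintro k ω ω' l h ⟨j, hj, hD⟩
    refine ⟨j, hj, ?_⟩
    have hi : ∀ i < l, ω i = ω' i := fun i hi => by
      have := congrArg (fun x => x.getD i false) h
      simpa [pre, hi] using this
    change _ ≤ _ at hD ⊢
    -- Each value on the orbit looks `L p` terms ahead, so the first `l` terms determine the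
    -- crossings up to `l - L p`.
    rwa [← crossings_congr fun i hil =>
      orbit_congr (N := l - L j.unpair.1) (hGpre _) (fun i' hi' => hi i' (by omega)) hil.le]
  · rintro k ω l l' hll ⟨j, hj, hD⟩
    exact ⟨j, by omega, le_trans hD (crossings_mono _ _ (by omega))⟩
  · rintro k ω ⟨j, hj, -⟩
    exact absurd hj (Nat.not_lt_zero j)
  · intro ω hω k
    obtain ⟨p, c, h⟩ := exists_crossings_unbounded (G := G) hC happrox hω
    obtain ⟨N, hN⟩ := h (2 * (2 ^ (k + Nat.pair p c + 1) * B p))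
    -- This length exceeds `j` and is still at least `N` after `L p` is subtracted.
    refine ⟨N + L p + Nat.pair p c + 1, Nat.pair p c, by omega, ?_⟩
    simp only [CrossingTest, Nat.unpair_pair]
    exact hN.trans (crossings_mono _ _ (by omega))
  · intro k
    calc P {ω | ∃ l, ∃ j < l, CrossingTest C L g k ω l j}
        ≤ P (⋃ j, {ω | ∃ N, 2 * (2 ^ (k + j + 1) * B j.unpair.1) ≤
            crossings j.unpair.2 (orbit (G j.unpair.1) ω) N}) := by
          refine measure_mono ?_
          rintro ω ⟨l, j, -, h⟩
          exact Set.mem_iUnion.2 ⟨j, _, h⟩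
      _ ≤ ∑' j, P {ω | ∃ N, 2 * (2 ^ (k + j + 1) * B j.unpair.1) ≤
            crossings j.unpair.2 (orbit (G j.unpair.1) ω) N} := measure_iUnion_le _
      _ ≤ ∑' j : ℕ, ((2 : ENNReal) ^ (k + j + 1))⁻¹ :=
          ENNReal.tsum_le_tsum fun j => measure_crossings_le hstat (hGpre _) (hGB _)
            (Nat.succ_pos _) _ _
      _ = (2 ^ k)⁻¹ := tsum_inv_two_pow_add k

end EffectiveErgodic

theorem mainTheorem1
    (P : Measure EffectiveErgodic.Cantor) [IsProbabilityMeasure P]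
    (hcomp : EffectiveErgodic.ComputableMeasure P)
    (hstat : MeasurePreserving EffectiveErgodic.shift P P)
    (f : EffectiveErgodic.Cantor → ℝ) (hf : EffectiveErgodic.ComputableFunction f) :
    (∃ C : ℝ, ∀ ω, |f ω| ≤ C) ∧
    (∀ ω, EffectiveErgodic.MartinLofRandom P ω → EffectiveErgodic.HasOrbitAverage f ω) ∧
    EffectiveErgodic.EffectivelyNull P {ω | ¬ EffectiveErgodic.HasOrbitAverage f ω} := by
  have hnull := hf.effectivelyNull_not_hasOrbitAverage hstat
  obtain ⟨C, -, -, -, -, hC, -⟩ := hf.exists_nat_approx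
  exact ⟨⟨C, hC⟩, fun ω hω => by_contra fun h => hω _ hnull h, hnull⟩
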